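/- Let $\{N(t):t\ge 0\}$ be a counting process on a probability space, i.e. an $\mathbb{N}$-valued process with nondecreasing, right-continuous paths (the law of $N(0)$ is arbitrary), and write $\Delta N(t)=N(t+h)-N(t)$ for $h>0$. Statements involving conditioning on $N(t)=n$ are understood for all $t\ge 0$ and $n\in\mathbb{N}$ with $P(N(t)=n)>0$. Assume that $\{N(t)\}$ is Markov and time homogeneous, that the limits $$q(n,k)=\lim_{h\downarrow 0}\frac{P(\Delta N(t)=k\mid N(t)=n)}{h}\ (k\ge 1),\qquad \lambda(n)=\lim_{h\downarrow 0}\frac{1-P(\Delta N(t)=0\mid N(t)=n)}{h}$$ exist and are finite, that the process is stable and conservative, i.e. $\lambda(n)=\sum_{k\ge 1}q(n,k)<\infty$ for all $n$, and that it is simple, i.e. $q(n,k)=0$ for all $n$ and all $k\ge 2$. For $\bar h>0$ let $\bar\Lambda(t)=\sup_{t\le s\le t+\bar h}\lambda(N(s))$. (P1) If for each $t$ and $n$ there is $\bar h>0$ such that $E[\bar\Lambda(t)\mid N(t)=n]<\infty$, then for all $t$ and $n$ the increment $\Delta N(t)$ has, for all small $h$, a finite conditional mean given $N(t)=n$, and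 the infinitesimal mean equals the rate: $$\lim_{h\downarrow 0}h^{-1}E[N(t+h)-N(t)\mid N(t)=n]=\lambda(n).$$ (P2) If for each $t$ and $n$ there is $\bar h>0$ such that $V[\bar\Lambda(t)\mid N(t)=n]<\infty$, then for all $t$ and $n$ the increment $\Delta N(t)$ has, for all small $h$, a finite conditional second moment given $N(t)=n$, the infinitesimal mean equals $\lambda(n)$, and so does the infinitesimal variance: $$\lim_{h\downarrow 0}h^{-1}V[N(t+h)-N(t)\mid N(t)=n]=\lambda(n).$$ Hence $\{N(t)\}$ is infinitesimally equi-dispersed: the infinitesimal dispersion index (the ratio of infinitesimal variance to infinitesimal mean) equals $1$ for all $t$ and all $n$ with $\lambda(n)\ne 0$, while both infinitesimal moments vanish if $\lambda(n)=0$. -/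

import Mathlib

open MeasureTheory ProbabilityTheory Filter Topology
open scoped NNReal ENNReal

namespace MCP

variable {Ω : Type*} [MeasurableSpace Ω]

/-- The event that the process `N` is in state `n` at time `t`. -/
def stateEvent (N : ℝ≥0 → Ω → ℕ) (t : ℝ≥0) (n : ℕ) : Set Ω := {ω | N t ω = n}

/-- The conditional probability measure `P( · | N(t) = n)`.  It is used only for pairs `(t, n)`
with `P(N(t) = n) > 0`. -/
noncomputable def condState (P : Measure Ω) (N : ℝ≥0 → Ω → ℕ) (t : ℝ≥0) (n : ℕ) : Measure Ω :=
  P[|stateEvent N t n]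

/-- The pair `(t, n)` is charged: `P(N(t) = n) > 0`. -/
def Charged (P : Measure Ω) (N : ℝ≥0 → Ω → ℕ) (t : ℝ≥0) (n : ℕ) : Prop :=
  0 < P (stateEvent N t n)

/-- The increment `ΔN(t) = N(t + h) - N(t)`, as a real random variable. -/
def increment (N : ℝ≥0 → Ω → ℕ) (t h : ℝ≥0) (ω : Ω) : ℝ := (N (t + h) ω : ℝ) - (N t ω : ℝ)

/-- A counting process: random variables with values in `ℕ` (in particular finite) whose paths are
nondecreasing and right-continuous. No restriction is put on the law of `N(0)`. -/
structure IsCountingProcess (N : ℝ≥0 → Ω → ℕ) : Prop where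
  measurable : ∀ t, Measurable (N t)
  mono : ∀ ω, Monotone fun t => N t ω
  rightCts : ∀ ω t, ContinuousWithinAt (fun s => N s ω) (Set.Ici t) t

/-- The Markov property with respect to the natural filtration `σ(N(s) : s ≤ t)`. -/
def IsMarkov (P : Measure Ω) (N : ℝ≥0 → Ω → ℕ) : Prop :=
  ∀ (t h : ℝ≥0) (n m : ℕ) (A : Set Ω),
    MeasurableSet[⨆ s : Set.Iic t, MeasurableSpace.comap (N s) ⊤] A →
    0 < P (stateEvent N t n ∩ A) →
      P[stateEvent N (t + h) m | stateEvent N t n ∩ A] =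
        P[stateEvent N (t + h) m | stateEvent N t n]

/-- Time homogeneity of the transition probabilities. -/
def IsTimeHomogeneous (P : Measure Ω) (N : ℝ≥0 → Ω → ℕ) : Prop :=
  ∀ (s t h : ℝ≥0) (n m : ℕ), Charged P N s n → Charged P N t n →
    P[stateEvent N (s + h) m | stateEvent N s n] = P[stateEvent N (t + h) m | stateEvent N t n]

/-- `q n k`, for `k ≥ 1`, are the infinitesimal probabilities of the process:
`q n k = lim_{h ↓ 0} P(ΔN(t) = k | N(t) = n) / h`. -/
def HasInfProbs (P : Measure Ω) (N : ℝ≥0 → Ω → ℕ) (q : ℕ → ℕ → ℝ) : Prop :=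
  ∀ (t : ℝ≥0) (n : ℕ), Charged P N t n → ∀ k : ℕ, 1 ≤ k →
    Tendsto (fun h : ℝ≥0 => (condState P N t n).real {ω | increment N t h ω = k} / (h : ℝ))
      (𝓝[>] 0) (𝓝 (q n k))

/-- `lam` is the (finite) infinitesimal rate function of the process:
`lam n = lim_{h ↓ 0} (1 - P(ΔN(t) = 0 | N(t) = n)) / h`. -/
def HasRate (P : Measure Ω) (N : ℝ≥0 → Ω → ℕ) (lam : ℕ → ℝ) : Prop :=
  ∀ (t : ℝ≥0) (n : ℕ), Charged P N t n →
    Tendsto (fun h : ℝ≥0 => (1 - (condState P N t n).real {ω | increment N t h ω = 0}) / (h : ℝ))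
      (𝓝[>] 0) (𝓝 (lam n))

/-- A state that the process occupies with positive probability at some time. For the other states
the conditional probabilities that define `q` and `lam` do not exist. -/
def Reachable (P : Measure Ω) (N : ℝ≥0 → Ω → ℕ) (n : ℕ) : Prop := ∃ t, Charged P N t n

/-- Stable and conservative: `lam n = ∑_{k ≥ 1} q n k < ∞`. -/
def IsStableConservative (P : Measure Ω) (N : ℝ≥0 → Ω → ℕ) (q : ℕ → ℕ → ℝ) (lam : ℕ → ℝ) : Prop :=
  ∀ n, Reachable P N n → HasSum (fun k : ℕ => q n (k + 1)) (lam n)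

/-- Simple: no jumps of size two or more. -/
def IsSimple (P : Measure Ω) (N : ℝ≥0 → Ω → ℕ) (q : ℕ → ℕ → ℝ) : Prop :=
  ∀ n, Reachable P N n → ∀ k : ℕ, 2 ≤ k → q n k = 0

/-- A simple, time homogeneous, stable and conservative Markov counting process with infinitesimal
probabilities `q` and rate function `lam`. -/
structure IsSimpleMCP (P : Measure Ω) (N : ℝ≥0 → Ω → ℕ) (q : ℕ → ℕ → ℝ) (lam : ℕ → ℝ) :
    Prop where
  counting : IsCountingProcess N
  markov : IsMarkov P N
  homogeneous : IsTimeHomogeneous P N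
  infProbs : HasInfProbs P N q
  rate : HasRate P N lam
  stableConservative : IsStableConservative P N q lam
  simple : IsSimple P N q

/-- `sup_{t ≤ s ≤ t + h} lam (N s)`. Along a nondecreasing path `N` takes finitely many values on
`[t, t + h]`, so that this is a supremum (in fact a maximum) of a finite set of reals. -/
noncomputable def supRate (N : ℝ≥0 → Ω → ℕ) (lam : ℕ → ℝ) (t h : ℝ≥0) (ω : Ω) : ℝ :=
  ⨆ s : Set.Icc t (t + h), lam (N s ω)

/-- Property P1: the supremum of the rate over a short window has finite conditional mean. -/
def P1 (P : Measure Ω) (N : ℝ≥0 → Ω → ℕ) (lam : ℕ → ℝ) : Prop :=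
  ∀ (t : ℝ≥0) (n : ℕ), Charged P N t n →
    ∃ h : ℝ≥0, 0 < h ∧ Integrable (supRate N lam t h) (condState P N t n)

/-- Property P2: the supremum of the rate over a short window has finite conditional variance
(the variance presupposes a finite mean). -/
def P2 (P : Measure Ω) (N : ℝ≥0 → Ω → ℕ) (lam : ℕ → ℝ) : Prop :=
  ∀ (t : ℝ≥0) (n : ℕ), Charged P N t n →
    ∃ h : ℝ≥0, 0 < h ∧ Integrable (supRate N lam t h) (condState P N t n) ∧
      evariance (supRate N lam t h) (condState P N t n) < ∞

/-- The infinitesimal mean at `(t, n)` exists and equals `μ`: the increments over short windows have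
finite conditional mean and `lim_{h ↓ 0} h⁻¹ E[N(t + h) - N(t) | N(t) = n] = μ`. -/
def HasInfMean (P : Measure Ω) (N : ℝ≥0 → Ω → ℕ) (t : ℝ≥0) (n : ℕ) (μ : ℝ) : Prop :=
  (∀ᶠ h in 𝓝[>] (0 : ℝ≥0), Integrable (increment N t h) (condState P N t n)) ∧
    Tendsto (fun h : ℝ≥0 => (h : ℝ)⁻¹ * ∫ ω, increment N t h ω ∂(condState P N t n))
      (𝓝[>] 0) (𝓝 μ)

/-- The infinitesimal variance at `(t, n)` exists and equals `v`: the increments over short windows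
have finite conditional second moment and
`lim_{h ↓ 0} h⁻¹ V[N(t + h) - N(t) | N(t) = n] = v`. -/
def HasInfVar (P : Measure Ω) (N : ℝ≥0 → Ω → ℕ) (t : ℝ≥0) (n : ℕ) (v : ℝ) : Prop :=
  (∀ᶠ h in 𝓝[>] (0 : ℝ≥0), MemLp (increment N t h) 2 (condState P N t n)) ∧
    Tendsto (fun h : ℝ≥0 => (h : ℝ)⁻¹ * variance (increment N t h) (condState P N t n))
      (𝓝[>] 0) (𝓝 v)

/-- Infinitesimally equi-dispersed: at all `t` and `n` the infinitesimal moments exist and their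
ratio, the infinitesimal dispersion index, is `1`; where the infinitesimal mean vanishes, so that
the index is not defined, the infinitesimal variance vanishes too. -/
def IsInfEquiDispersed (P : Measure Ω) (N : ℝ≥0 → Ω → ℕ) : Prop :=
  ∀ (t : ℝ≥0) (n : ℕ), Charged P N t n →
    ∃ μ v : ℝ, HasInfMean P N t n μ ∧ HasInfVar P N t n v ∧
      (μ ≠ 0 → v / μ = 1) ∧ (μ = 0 → v = 0)

end MCP

set_option linter.unusedSectionVars false

namespace MCP

variable {Ω : Type*} [MeasurableSpace Ω] {P : Measure Ω} [IsProbabilityMeasure P]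
  {N : ℝ≥0 → Ω → ℕ} {q : ℕ → ℕ → ℝ} {lam : ℕ → ℝ}

/-! Fix a charged `(t, n)`. Since paths are nondecreasing, the event `N ≤ m` loses mass only through
the finitely many states `j ≤ m`. Conservativity and simplicity give `q j 1 = lam j`, so to first
order only `m` itself feeds the states above it. Hence `P(N(t+s) ≤ m | N(t) = n)` has right
derivative `-lam m * P(N(t+s) = m | N(t) = n)`. It is also continuous, so this integrates to a
formula for each tail with `m ≥ n` (`condState_Ioi_eq_integral`).

Summing the tails against weights `W m` gives Dynkin's formula (`lintegral_sum_range`) by Tonelli,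
with no integrability assumption. Weight `1` on `m ≥ n` produces the increment, weight `2 * (m - n)
+ 1` its square. As the window shrinks, right-continuity freezes the path at `n`, and dominated
convergence gives the limit `W n * lam n = lam n` in both cases.

The supremum of the rate dominates for the mean. For the square the dominating function also
contains the squared increment, whose expectation is first shown finite by a truncated self-bounding
estimate (`lintegral_trunc_sq_le`). The squared mean is `o(h)`, so the variance has the same limit.
-/

/-! ### Conditional laws, transition measures and the Markov property -/

theorem measurableSet_stateEvent (hc : IsCountingProcess N) (t : ℝ≥0) (n : ℕ) :
    MeasurableSet (stateEvent N t n) :=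
  hc.measurable t (MeasurableSet.singleton n)

theorem isProbabilityMeasure_condState {t : ℝ≥0} {n : ℕ} (h : Charged P N t n) :
    IsProbabilityMeasure (condState P N t n) :=
  cond_isProbabilityMeasure h.ne'

theorem ae_condState (hc : IsCountingProcess N) (t : ℝ≥0) (n : ℕ) :
    ∀ᵐ ω ∂(condState P N t n), N t ω = n :=
  ae_cond_mem (measurableSet_stateEvent hc t n)

/-- The law of `N(u + ε)` given `N(u) = j`, which by homogeneity does not depend on `u`; it is `0`
for states `j` that are not reachable. -/
noncomputable def transition (P : Measure Ω) (N : ℝ≥0 → Ω → ℕ) (j : ℕ) (ε : ℝ≥0) : Measure ℕ :=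
  open Classical in
  if h : Reachable P N j then (condState P N h.choose j).map (N (h.choose + ε)) else 0

theorem map_condState (hc : IsCountingProcess N) (hh : IsTimeHomogeneous P N) {u : ℝ≥0} {j : ℕ}
    (hu : Charged P N u j) (ε : ℝ≥0) :
    (condState P N u j).map (N (u + ε)) = transition P N j ε := by
  have hr : Reachable P N j := ⟨u, hu⟩
  rw [transition, dif_pos hr]
  refine Measure.ext_of_singleton fun m => ?_
  rw [Measure.map_apply (hc.measurable _) (MeasurableSet.singleton m),
    Measure.map_apply (hc.measurable _) (MeasurableSet.singleton m)]
  exact hh u hr.choose ε j m hu hr.choose_spec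

instance isFiniteMeasure_transition (j : ℕ) (ε : ℝ≥0) : IsFiniteMeasure (transition P N j ε) := by
  unfold transition condState
  split_ifs <;> infer_instance

theorem transition_of_not_reachable {j : ℕ} (h : ¬ Reachable P N j) (ε : ℝ≥0) :
    transition P N j ε = 0 := by
  rw [transition, dif_neg h]

/-- The event `N t = n` belongs to the history up to `u`, so the Markov property discards it; on a
countable state space singletons determine the law. -/
theorem map_cond_inter (hc : IsCountingProcess N) (hM : IsMarkov P N) {t u : ℝ≥0} (htu : t ≤ u)
    (n j : ℕ) (hpos : 0 < P (stateEvent N u j ∩ stateEvent N t n)) (ε : ℝ≥0) :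
    (P[|stateEvent N u j ∩ stateEvent N t n]).map (N (u + ε)) =
      (condState P N u j).map (N (u + ε)) := by
  refine Measure.ext_of_singleton fun m => ?_
  rw [Measure.map_apply (hc.measurable _) (MeasurableSet.singleton m),
    Measure.map_apply (hc.measurable _) (MeasurableSet.singleton m)]
  refine hM u ε j m _ ?_ hpos
  have hle : MeasurableSpace.comap (N t) ⊤ ≤
      ⨆ s : Set.Iic u, MeasurableSpace.comap (N s) ⊤ :=
    le_iSup (fun s : Set.Iic u => MeasurableSpace.comap (N s) ⊤) ⟨t, htu⟩
  exact hle _ ⟨{n}, trivial, rfl⟩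

/-- The Markov property at time `u ≥ t` under the conditional law given `N(t) = n`. -/
theorem condState_inter_preimage (hc : IsCountingProcess N) (hM : IsMarkov P N)
    (hh : IsTimeHomogeneous P N) {t u : ℝ≥0} (htu : t ≤ u) (n j : ℕ) (ε : ℝ≥0) (S : Set ℕ) :
    condState P N t n (stateEvent N u j ∩ N (u + ε) ⁻¹' S) =
      transition P N j ε S * condState P N t n (stateEvent N u j) := by
  have hA := measurableSet_stateEvent hc t n
  have hB := measurableSet_stateEvent hc u j
  rcases eq_or_ne (P (stateEvent N u j ∩ stateEvent N t n)) 0 with h0 | h0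
  · have h1 : condState P N t n (stateEvent N u j) = 0 := by
      rw [condState, cond_apply hA, Set.inter_comm, h0, mul_zero]
    rw [h1, mul_zero]
    exact measure_mono_null Set.inter_subset_left h1
  · have hu : Charged P N u j :=
      (pos_iff_ne_zero.2 h0).trans_le (measure_mono Set.inter_subset_left)
    have hpos := pos_iff_ne_zero.2 h0
    have : IsFiniteMeasure (condState P N t n) := by unfold condState; infer_instance
    rw [← cond_mul_eq_inter hB, ← map_condState hc hh hu, ← map_cond_inter hc hM htu n j hpos,
      Measure.map_apply (hc.measurable _) (Set.to_countable S).measurableSet, condState,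
      cond_cond_eq_cond_inter hA hB, Set.inter_comm]

/-! ### Infinitesimal behaviour of the transition measures -/

theorem transition_Ioi_self (hc : IsCountingProcess N) (hh : IsTimeHomogeneous P N) {u : ℝ≥0}
    {j : ℕ} (hu : Charged P N u j) (ε : ℝ≥0) :
    (transition P N j ε).real (Set.Ioi j) =
      1 - (condState P N u j).real {ω | increment N u ε ω = 0} := by
  have := isProbabilityMeasure_condState hu
  have hset : MeasurableSet {ω | increment N u ε ω = 0} := by
    have : Measurable (increment N u ε) :=
      (measurable_from_top.comp (hc.measurable (u + ε))).sub
        (measurable_from_top.comp (hc.measurable u))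
    exact this (MeasurableSet.singleton 0)
  rw [← probReal_compl_eq_one_sub hset, ← map_condState hc hh hu,
    map_measureReal_apply (hc.measurable _) (Set.to_countable _).measurableSet]
  refine measureReal_congr ?_
  filter_upwards [ae_condState hc u j] with ω hω
  have hle : N u ω ≤ N (u + ε) ω := hc.mono ω le_self_add
  refine propext ?_
  change j < N (u + ε) ω ↔ ¬ ((N (u + ε) ω : ℝ) - (N u ω : ℝ) = 0)
  rw [sub_eq_zero, Nat.cast_inj, ← hω]
  omega

theorem transition_singleton (hc : IsCountingProcess N) (hh : IsTimeHomogeneous P N) {u : ℝ≥0}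
    {j : ℕ} (hu : Charged P N u j) (ε : ℝ≥0) (k : ℕ) :
    (transition P N j ε).real {j + k} =
      (condState P N u j).real {ω | increment N u ε ω = k} := by
  rw [← map_condState hc hh hu, map_measureReal_apply (hc.measurable _) (MeasurableSet.singleton _)]
  refine measureReal_congr ?_
  filter_upwards [ae_condState hc u j] with ω hω
  refine propext ?_
  change N (u + ε) ω = j + k ↔ (N (u + ε) ω : ℝ) - (N u ω : ℝ) = k
  rw [sub_eq_iff_eq_add, ← Nat.cast_add, Nat.cast_inj, hω, add_comm k]

/-- The rate settles `d = 0`, and each further step removes one point from the tail. Only finitely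
many limits are combined, so no limit is exchanged with an infinite sum. -/
theorem tendsto_transition_Ioi_sum (hN : IsSimpleMCP P N q lam) {j : ℕ} (hj : Reachable P N j)
    (d : ℕ) :
    Tendsto (fun ε : ℝ≥0 => (transition P N j ε).real (Set.Ioi (j + d)) / (ε : ℝ)) (𝓝[>] 0)
      (𝓝 (lam j - ∑ k ∈ Finset.range d, q j (k + 1))) := by
  obtain ⟨u, hu⟩ := hj
  induction d with
  | zero =>
    simp only [add_zero, Finset.range_zero, Finset.sum_empty, sub_zero]
    simp_rw [transition_Ioi_self hN.counting hN.homogeneous hu]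
    exact hN.rate u j hu
  | succ d ih =>
    rw [Finset.sum_range_succ, ← sub_sub]
    refine (ih.sub (hN.infProbs u j hu (d + 1) (by omega))).congr fun ε => ?_
    rw [← sub_div, ← transition_singleton hN.counting hN.homogeneous hu]
    have : Set.Ioi (j + (d + 1)) = Set.Ioi (j + d) \ {j + (d + 1)} := by
      ext x; simp only [Set.mem_Ioi, Set.mem_sdiff, Set.mem_singleton_iff]; omega
    rw [this, measureReal_sdiff (by simp) (MeasurableSet.singleton _)]

theorem IsSimpleMCP.q_one (hN : IsSimpleMCP P N q lam) {j : ℕ} (hj : Reachable P N j) :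
    q j 1 = lam j := by
  refine HasSum.unique (hasSum_single 0 fun k hk => ?_) (hN.stableConservative j hj)
  exact hN.simple j hj (k + 1) (by omega)

/-- Over short periods only the state `m` itself feeds the states above `m`. -/
theorem tendsto_transition_Ioi (hN : IsSimpleMCP P N q lam) {j m : ℕ} (hj : Reachable P N j)
    (hjm : j ≤ m) :
    Tendsto (fun ε : ℝ≥0 => (transition P N j ε).real (Set.Ioi m) / (ε : ℝ)) (𝓝[>] 0)
      (𝓝 (if j = m then lam m else 0)) := by
  obtain ⟨d, rfl⟩ := Nat.exists_eq_add_of_le hjm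
  convert tendsto_transition_Ioi_sum hN hj d using 2
  rcases d with _ | d
  · simp
  -- For `j < m` the finite sum contains `q j 1 = lam j`, which cancels the total rate; the other
  -- terms vanish by simplicity.
  · rw [if_neg (by omega), Finset.sum_range_succ', Finset.sum_eq_zero fun k _ =>
      hN.simple j hj _ (by omega), hN.q_one hj]
    simp

theorem lam_nonneg (hN : IsSimpleMCP P N q lam) {j : ℕ} (hj : Reachable P N j) : 0 ≤ lam j := by
  have h := tendsto_transition_Ioi hN hj le_rfl
  rw [if_pos rfl] at h
  exact ge_of_tendsto' h fun ε => by positivity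

theorem tendsto_transition_Ioi_zero (hN : IsSimpleMCP P N q lam) {j m : ℕ} (hjm : j ≤ m) :
    Tendsto (fun ε : ℝ≥0 => (transition P N j ε).real (Set.Ioi m)) (𝓝[>] 0) (𝓝 0) := by
  by_cases hj : Reachable P N j
  · have h1 : Tendsto (fun ε : ℝ≥0 => (ε : ℝ)) (𝓝[>] 0) (𝓝 0) :=
      tendsto_nhdsWithin_of_tendsto_nhds (NNReal.continuous_coe.tendsto' 0 0 rfl)
    have h2 := (tendsto_transition_Ioi hN hj hjm).mul h1
    rw [mul_zero] at h2
    refine h2.congr' ?_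
    filter_upwards [self_mem_nhdsWithin] with ε hε
    have : (ε : ℝ) ≠ 0 := by simpa using (ne_of_gt hε : ε ≠ 0)
    field_simp
  · simp [transition_of_not_reachable hj]

/-! ### The forward equation -/

/-- By monotonicity the lost mass consists of paths at some `j ≤ m` at time `u` and above `m` at
time `u + ε`. Working with lower sets keeps the sum over `j` finite. -/
theorem condState_real_Iic_sub (hN : IsSimpleMCP P N q lam) {t u : ℝ≥0} (htu : t ≤ u)
    (n m : ℕ) (ε : ℝ≥0) :
    (condState P N t n).real (N u ⁻¹' Set.Iic m) -
        (condState P N t n).real (N (u + ε) ⁻¹' Set.Iic m) =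
      ∑ j ∈ Finset.range (m + 1),
        (transition P N j ε).real (Set.Ioi m) * (condState P N t n).real (stateEvent N u j) := by
  have hc := hN.counting
  have : IsFiniteMeasure (condState P N t n) := by unfold condState; infer_instance
  have hsub : N (u + ε) ⁻¹' Set.Iic m ⊆ N u ⁻¹' Set.Iic m :=
    fun ω hω => le_trans (hc.mono ω le_self_add) hω
  rw [← measureReal_sdiff hsub (hc.measurable _ (Set.to_countable _).measurableSet)]
  have hset : N u ⁻¹' Set.Iic m \ N (u + ε) ⁻¹' Set.Iic m =
      ⋃ j ∈ Finset.range (m + 1), stateEvent N u j ∩ N (u + ε) ⁻¹' Set.Ioi m := by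
    ext ω
    simp [stateEvent]
  rw [hset, measureReal_biUnion_finset]
  · refine Finset.sum_congr rfl fun j _ => ?_
    simp only [measureReal_def]
    rw [condState_inter_preimage hc hN.markov hN.homogeneous htu, ENNReal.toReal_mul]
  · intro i _ j _ hij
    refine Set.disjoint_left.2 fun ω hi hj => hij ?_
    exact hi.1.symm.trans hj.1
  · intro j _
    exact (measurableSet_stateEvent hc u j).inter
      (hc.measurable _ (Set.to_countable _).measurableSet)

theorem measureReal_stateEvent_eq_zero {t u : ℝ≥0} {n j : ℕ} (hj : ¬ Reachable P N j) :
    (condState P N t n).real (stateEvent N u j) = 0 := by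
  have h0 : P (stateEvent N u j) = 0 := by
    by_contra h
    exact hj ⟨u, pos_iff_ne_zero.2 h⟩
  have h1 : condState P N t n (stateEvent N u j) = 0 := cond_absolutelyContinuous h0
  rw [measureReal_def, h1, ENNReal.toReal_zero]

theorem tendsto_forward (hN : IsSimpleMCP P N q lam) {t u : ℝ≥0} (htu : t ≤ u) (n m : ℕ) :
    Tendsto (fun ε : ℝ≥0 => ((condState P N t n).real (N u ⁻¹' Set.Iic m) -
        (condState P N t n).real (N (u + ε) ⁻¹' Set.Iic m)) / (ε : ℝ)) (𝓝[>] 0)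
      (𝓝 (lam m * (condState P N t n).real (stateEvent N u m))) := by
  simp_rw [condState_real_Iic_sub hN htu, Finset.sum_div]
  have : lam m * (condState P N t n).real (stateEvent N u m) =
      ∑ j ∈ Finset.range (m + 1),
        (if j = m then lam m else 0) * (condState P N t n).real (stateEvent N u j) := by
    simp
  rw [this]
  refine tendsto_finsetSum _ fun j hj => ?_
  by_cases hr : Reachable P N j
  · simp_rw [mul_div_right_comm]
    exact (tendsto_transition_Ioi hN hr (Nat.lt_succ_iff.1 (Finset.mem_range.1 hj))).mul_const _
  · simp [measureReal_stateEvent_eq_zero hr]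

/-- The forward limits see only the right of each time. Homogeneity bounds the change by a modulus
independent of the base time, which yields left continuity as well; integrating a right derivative
requires it. -/
theorem continuous_condState_Iic (hN : IsSimpleMCP P N q lam) {t : ℝ≥0} {n : ℕ}
    (hn : Charged P N t n) (m : ℕ) :
    Continuous fun s : ℝ≥0 => (condState P N t n).real (N (t + s) ⁻¹' Set.Iic m) := by
  have := isProbabilityMeasure_condState hn
  set F : ℝ≥0 → ℝ := fun s => (condState P N t n).real (N (t + s) ⁻¹' Set.Iic m) with hF
  set H : ℝ≥0 → ℝ := fun ε =>
    ∑ j ∈ Finset.range (m + 1), (transition P N j ε).real (Set.Ioi m) with hH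
  have hH0 : Tendsto H (𝓝[>] 0) (𝓝 0) := by
    have h0 : (0 : ℝ) = ∑ _j ∈ Finset.range (m + 1), 0 := Finset.sum_const_zero.symm
    rw [h0]
    exact tendsto_finsetSum _ fun j hj =>
      tendsto_transition_Ioi_zero hN (Nat.lt_succ_iff.1 (Finset.mem_range.1 hj))
  have hstep : ∀ s ε : ℝ≥0, |F s - F (s + ε)| ≤ H ε := by
    intro s ε
    have h := condState_real_Iic_sub hN (le_self_add : t ≤ t + s) n m ε
    rw [add_assoc] at h
    simp only [hF, h]
    rw [abs_of_nonneg (by positivity)]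
    exact Finset.sum_le_sum fun j _ =>
      mul_le_of_le_one_right measureReal_nonneg measureReal_le_one
  have hle : ∀ a b : ℝ≥0, |F a - F b| ≤ H (max a b - min a b) := by
    intro a b
    rcases le_total a b with hab | hab
    · have := hstep a (b - a)
      rw [add_tsub_cancel_of_le hab] at this
      simpa [max_eq_right hab, min_eq_left hab] using this
    · have := hstep b (a - b)
      rw [add_tsub_cancel_of_le hab, abs_sub_comm] at this
      simpa [max_eq_left hab, min_eq_right hab] using this
  rw [continuous_iff_continuousAt]
  intro a
  rw [continuousAt_iff_punctured_nhds]
  have hdist : Tendsto (fun b : ℝ≥0 => max a b - min a b) (𝓝[≠] a) (𝓝[>] 0) := by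
    refine tendsto_nhdsWithin_iff.2 ⟨tendsto_nhdsWithin_of_tendsto_nhds ?_, ?_⟩
    · exact Continuous.tendsto' (by fun_prop) _ _ (by simp)
    · filter_upwards [self_mem_nhdsWithin] with b hb
      have : min a b < max a b := min_lt_max.2 (Ne.symm hb)
      exact tsub_pos_of_lt this
  rw [tendsto_iff_dist_tendsto_zero]
  refine squeeze_zero (fun _ => dist_nonneg) (fun b => ?_) (hH0.comp hdist)
  rw [dist_comm, Real.dist_eq]
  exact hle a b

theorem continuous_condState_stateEvent (hN : IsSimpleMCP P N q lam) {t : ℝ≥0} {n : ℕ}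
    (hn : Charged P N t n) (m : ℕ) :
    Continuous fun s : ℝ≥0 => (condState P N t n).real (stateEvent N (t + s) m) := by
  have := isProbabilityMeasure_condState hn
  rcases m with _ | m
  · convert continuous_condState_Iic hN hn 0 using 4 with s
    ext ω; simp [stateEvent]
  · convert (continuous_condState_Iic hN hn (m + 1)).sub (continuous_condState_Iic hN hn m)
      using 2 with s
    rw [Pi.sub_apply, ← measureReal_sdiff (Set.preimage_mono (Set.Iic_subset_Iic.2 (Nat.le_succ m)))
      (hN.counting.measurable _ (Set.to_countable _).measurableSet)]
    congr 1
    ext ω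
    simp only [stateEvent, Set.mem_ofPred_eq, Set.mem_sdiff, Set.mem_preimage, Set.mem_Iic]
    omega

theorem hasDerivWithinAt_condState_Iic (hN : IsSimpleMCP P N q lam) {t : ℝ≥0} (n m : ℕ)
    {s : ℝ} (hs : 0 ≤ s) :
    HasDerivWithinAt
      (fun x : ℝ => (condState P N t n).real (N (t + x.toNNReal) ⁻¹' Set.Iic m))
      (-(lam m * (condState P N t n).real (stateEvent N (t + s.toNNReal) m))) (Set.Ioi s) s := by
  rw [hasDerivWithinAt_iff_tendsto_slope' Set.self_notMem_Ioi]
  have hsub : Tendsto (fun x : ℝ => (x - s).toNNReal) (𝓝[>] s) (𝓝[>] 0) := by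
    refine tendsto_nhdsWithin_iff.2 ⟨tendsto_nhdsWithin_of_tendsto_nhds ?_, ?_⟩
    · exact Continuous.tendsto' (by fun_prop) _ _ (by simp)
    · filter_upwards [self_mem_nhdsWithin] with x hx
      exact Real.toNNReal_pos.2 (sub_pos.2 hx)
  refine ((tendsto_forward hN (le_self_add : t ≤ t + s.toNNReal) n m).comp hsub).neg.congr' ?_
  filter_upwards [self_mem_nhdsWithin] with x hx
  have hx' : s < x := hx
  have h1 : t + s.toNNReal + (x - s).toNNReal = t + x.toNNReal := by
    rw [add_assoc, ← Real.toNNReal_add hs (by linarith), add_sub_cancel]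
  simp only [Function.comp_apply, slope_def_field, h1]
  rw [Real.coe_toNNReal _ (by linarith), ← neg_div, neg_sub]

/-- The integrated forward equation for the tail probabilities. -/
theorem condState_Ioi_eq_integral (hN : IsSimpleMCP P N q lam) {t : ℝ≥0} {n m : ℕ}
    (hn : Charged P N t n) (hnm : n ≤ m) (h : ℝ≥0) :
    (condState P N t n).real (N (t + h) ⁻¹' Set.Ioi m) =
      ∫ s in (0 : ℝ)..h, lam m * (condState P N t n).real (stateEvent N (t + s.toNNReal) m) := by
  have := isProbabilityMeasure_condState hn
  have hp := (continuous_condState_stateEvent hN hn m).comp continuous_real_toNNReal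
  have hF := (continuous_condState_Iic hN hn m).comp continuous_real_toNNReal
  have hint := intervalIntegral.integral_eq_sub_of_hasDeriv_right (a := (0 : ℝ)) (b := h)
    hF.continuousOn
    (fun x hx => hasDerivWithinAt_condState_Iic hN n m (by simpa using hx.1.le))
    ((hp.const_mul (lam m)).neg.intervalIntegrable _ _)
  -- The path starts at `n ≤ m`, so all the mass lies in `Iic m` at time zero.
  have h0 : (condState P N t n).real (N (t + (0 : ℝ).toNNReal) ⁻¹' Set.Iic m) = 1 := by
    rw [Real.toNNReal_zero, add_zero, measureReal_def, (mem_ae_iff_prob_eq_one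
      (hN.counting.measurable _ (Set.to_countable _).measurableSet)).1, ENNReal.toReal_one]
    filter_upwards [ae_condState hN.counting t n] with ω hω
    exact hω.trans_le hnm
  have hcompl : N (t + h) ⁻¹' Set.Ioi m = (N (t + h) ⁻¹' Set.Iic m)ᶜ := by
    rw [← Set.preimage_compl, Set.compl_Iic]
  rw [hcompl, probReal_compl_eq_one_sub
    (hN.counting.measurable _ (Set.to_countable _).measurableSet)]
  rw [intervalIntegral.integral_neg] at hint
  simp only [Function.comp_apply, h0, Real.toNNReal_coe] at hint
  linarith

theorem measurable_condState_stateEvent (hN : IsSimpleMCP P N q lam) {t : ℝ≥0} {n : ℕ}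
    (hn : Charged P N t n) (m : ℕ) :
    Measurable fun s : ℝ => condState P N t n (stateEvent N (t + s.toNNReal) m) := by
  have := isProbabilityMeasure_condState hn
  have h := ((continuous_condState_stateEvent hN hn m).comp
    continuous_real_toNNReal).measurable.ennreal_ofReal
  simpa [measureReal_def, Function.comp_def] using h

theorem condState_Ioi_eq_lintegral (hN : IsSimpleMCP P N q lam) {t : ℝ≥0} {n m : ℕ}
    (hn : Charged P N t n) (hnm : n ≤ m) (h : ℝ≥0) :
    condState P N t n (N (t + h) ⁻¹' Set.Ioi m) =
      ∫⁻ s in Set.Ioc (0 : ℝ) h,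
        ENNReal.ofReal (lam m) * condState P N t n (stateEvent N (t + s.toNNReal) m) := by
  have := isProbabilityMeasure_condState hn
  have hp : Continuous fun s : ℝ =>
      lam m * (condState P N t n).real (stateEvent N (t + s.toNNReal) m) :=
    ((continuous_condState_stateEvent hN hn m).comp continuous_real_toNNReal).const_mul (lam m)
  have hpos : ∀ s : ℝ, 0 ≤ lam m * (condState P N t n).real
      (stateEvent N (t + s.toNNReal) m) := by
    intro s
    -- At an unreachable state `lam m` may have any sign, but the state carries no mass.
    by_cases hr : Reachable P N m
    · exact mul_nonneg (lam_nonneg hN hr) measureReal_nonneg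
    · rw [measureReal_stateEvent_eq_zero hr, mul_zero]
  rw [← ENNReal.ofReal_toReal (measure_ne_top (condState P N t n) _), ← measureReal_def,
    condState_Ioi_eq_integral hN hn hnm, intervalIntegral.integral_of_le h.coe_nonneg,
    ofReal_integral_eq_lintegral_ofReal hp.integrableOn_Ioc (ae_of_all _ hpos)]
  refine lintegral_congr fun s => ?_
  rw [ENNReal.ofReal_mul' measureReal_nonneg, measureReal_def,
    ENNReal.ofReal_toReal (measure_ne_top _ _)]

/-! ### Dynkin's formula and its small-time limit -/

theorem lintegral_comp_eq_tsum (hc : IsCountingProcess N) (μ : Measure Ω) (u : ℝ≥0)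
    (f : ℕ → ℝ≥0∞) : ∫⁻ ω, f (N u ω) ∂μ = ∑' m, f m * μ (stateEvent N u m) := by
  rw [← lintegral_map measurable_from_top (hc.measurable u), lintegral_countable']
  exact tsum_congr fun m => by
    rw [Measure.map_apply (hc.measurable u) (MeasurableSet.singleton m)]; rfl

/-- Dynkin's formula for the functional `x ↦ ∑ m < x, W m`. -/
theorem lintegral_sum_range (hN : IsSimpleMCP P N q lam) {t : ℝ≥0} {n : ℕ}
    (hn : Charged P N t n) {W : ℕ → ℕ} (hW : ∀ m < n, W m = 0) (h : ℝ≥0) :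
    ∫⁻ ω, ((∑ m ∈ Finset.range (N (t + h) ω), W m : ℕ) : ℝ≥0∞) ∂(condState P N t n) =
      ∫⁻ s in Set.Ioc (0 : ℝ) h, ∫⁻ ω, (W (N (t + s.toNNReal) ω) : ℝ≥0∞) *
        ENNReal.ofReal (lam (N (t + s.toNNReal) ω)) ∂(condState P N t n) := by
  have hc := hN.counting
  -- Layer-cake form: the sum over `m < N` is the sum of `W m` over the events `N > m`.
  have hsum : ∀ ω, ((∑ m ∈ Finset.range (N (t + h) ω), W m : ℕ) : ℝ≥0∞) =
      ∑' m, (N (t + h) ⁻¹' Set.Ioi m).indicator (fun _ => (W m : ℝ≥0∞)) ω := by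
    intro ω
    rw [tsum_eq_sum (s := Finset.range (N (t + h) ω))]
    · push_cast
      refine Finset.sum_congr rfl fun m hm => ?_
      rw [Set.indicator_of_mem]
      exact Finset.mem_range.1 hm
    · intro m hm
      rw [Set.indicator_of_notMem]
      exact fun hm' => hm (Finset.mem_range.2 hm')
  have hms : ∀ m, MeasurableSet (N (t + h) ⁻¹' Set.Ioi m) := fun m =>
    hc.measurable _ (Set.to_countable _).measurableSet
  simp_rw [hsum]
  rw [lintegral_tsum fun m => (measurable_const.indicator (hms m)).aemeasurable]
  simp_rw [lintegral_comp_eq_tsum hc _ _ fun k => (W k : ℝ≥0∞) * ENNReal.ofReal (lam k)]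
  rw [lintegral_tsum fun m =>
    ((measurable_condState_stateEvent hN hn m).const_mul _).aemeasurable]
  refine tsum_congr fun m => ?_
  rw [lintegral_indicator_const (hms m)]
  -- The tail formula is available only for `m ≥ n`; below `n` the weight vanishes.
  rcases lt_or_ge m n with hm | hm
  · simp [hW m hm]
  · rw [condState_Ioi_eq_lintegral hN hn hm, ← lintegral_const_mul _
      ((measurable_condState_stateEvent hN hn m).const_mul _)]
    simp_rw [mul_assoc]

theorem tendsto_setLIntegral_Ioc_div {g : ℝ → ℝ≥0∞} {L : ℝ≥0∞} (hL : L ≠ ∞)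
    (hg : Tendsto g (𝓝[>] 0) (𝓝 L)) :
    Tendsto (fun h : ℝ≥0 => (∫⁻ s in Set.Ioc (0 : ℝ) h, g s) / (h : ℝ≥0∞)) (𝓝[>] 0) (𝓝 L) := by
  rw [ENNReal.tendsto_nhds hL] at hg ⊢
  intro ε hε
  obtain ⟨δ, hδ, hsub⟩ := mem_nhdsGT_iff_exists_Ioc_subset.1 (hg ε hε)
  have hδ' : (0 : ℝ≥0) < δ.toNNReal := Real.toNNReal_pos.2 hδ
  filter_upwards [Ioc_mem_nhdsGT hδ'] with h hh
  have hh0 : (h : ℝ≥0∞) ≠ 0 := by simpa using hh.1.ne'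
  have hmem : ∀ s ∈ Set.Ioc (0 : ℝ) h, g s ∈ Set.Icc (L - ε) (L + ε) := fun s hs =>
    hsub ⟨hs.1, hs.2.trans ((NNReal.coe_le_coe.2 hh.2).trans_eq (Real.coe_toNNReal δ hδ.le))⟩
  have hvol : volume (Set.Ioc (0 : ℝ) h) = (h : ℝ≥0∞) := by
    rw [Real.volume_Ioc, sub_zero, ENNReal.ofReal_coe_nnreal]
  constructor
  · rw [ENNReal.le_div_iff_mul_le (Or.inl hh0) (Or.inl ENNReal.coe_ne_top), ← hvol,
      ← setLIntegral_const]
    exact setLIntegral_mono' measurableSet_Ioc fun s hs => (hmem s hs).1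
  · refine ENNReal.div_le_of_le_mul ?_
    rw [← hvol, ← setLIntegral_const]
    exact setLIntegral_mono' measurableSet_Ioc fun s hs => (hmem s hs).2

theorem lintegral_sum_range_le (hN : IsSimpleMCP P N q lam) {t : ℝ≥0} {n : ℕ}
    (hn : Charged P N t n) {W : ℕ → ℕ} (hW : ∀ m < n, W m = 0) {h : ℝ≥0} {D : Ω → ℝ≥0∞}
    (hD : ∀ s ≤ h, ∀ᵐ ω ∂(condState P N t n),
      (W (N (t + s) ω) : ℝ≥0∞) * ENNReal.ofReal (lam (N (t + s) ω)) ≤ D ω) :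
    ∫⁻ ω, ((∑ m ∈ Finset.range (N (t + h) ω), W m : ℕ) : ℝ≥0∞) ∂(condState P N t n) ≤
      (∫⁻ ω, D ω ∂(condState P N t n)) * h := by
  have hvol : volume (Set.Ioc (0 : ℝ) h) = (h : ℝ≥0∞) := by
    rw [Real.volume_Ioc, sub_zero, ENNReal.ofReal_coe_nnreal]
  rw [lintegral_sum_range hN hn hW, ← hvol, ← setLIntegral_const]
  exact setLIntegral_mono' measurableSet_Ioc fun s hs =>
    lintegral_mono_ae (hD _ (Real.toNNReal_le_iff_le_coe.2 hs.2))

theorem eventually_eq_of_rightCts (hc : IsCountingProcess N) (t : ℝ≥0) (ω : Ω) :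
    ∀ᶠ s : ℝ in 𝓝[>] 0, N (t + s.toNNReal) ω = N t ω := by
  have h1 : Tendsto (fun s : ℝ => t + s.toNNReal) (𝓝[>] 0) (𝓝[≥] t) := by
    refine tendsto_nhdsWithin_iff.2 ⟨tendsto_nhdsWithin_of_tendsto_nhds ?_, ?_⟩
    · exact Continuous.tendsto' (by fun_prop) _ _ (by simp)
    · exact Eventually.of_forall fun s => le_self_add (a := t)
  have h2 : Tendsto (fun s : ℝ => N (t + s.toNNReal) ω) (𝓝[>] 0) (𝓝 (N t ω)) :=
    Tendsto.comp (hc.rightCts ω t) h1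
  rw [nhds_discrete, tendsto_pure] at h2
  exact h2

/-- The discrete-valued path stays at `n` for a short random time, so the integrand in Dynkin's
formula converges almost surely; `D` supplies the domination and the time average inherits the
limit. -/
theorem tendsto_lintegral_sum_range_div (hN : IsSimpleMCP P N q lam) {t : ℝ≥0} {n : ℕ}
    (hn : Charged P N t n) {W : ℕ → ℕ} (hW : ∀ m < n, W m = 0) {δ : ℝ≥0} (hδ : 0 < δ)
    {D : Ω → ℝ≥0∞} (hDi : ∫⁻ ω, D ω ∂(condState P N t n) ≠ ∞)
    (hD : ∀ s ≤ δ, ∀ᵐ ω ∂(condState P N t n),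
      (W (N (t + s) ω) : ℝ≥0∞) * ENNReal.ofReal (lam (N (t + s) ω)) ≤ D ω) :
    Tendsto (fun h : ℝ≥0 => (∫⁻ ω, ((∑ m ∈ Finset.range (N (t + h) ω), W m : ℕ) : ℝ≥0∞)
      ∂(condState P N t n)) / (h : ℝ≥0∞)) (𝓝[>] 0) (𝓝 (W n * ENNReal.ofReal (lam n))) := by
  have := isProbabilityMeasure_condState hn
  have hc := hN.counting
  simp_rw [lintegral_sum_range hN hn hW]
  refine tendsto_setLIntegral_Ioc_div (by finiteness) ?_
  have hlim : ∫⁻ _ω, (W n : ℝ≥0∞) * ENNReal.ofReal (lam n) ∂(condState P N t n) =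
      W n * ENNReal.ofReal (lam n) := by simp
  rw [← hlim]
  refine tendsto_lintegral_filter_of_dominated_convergence D ?_ ?_ hDi ?_
  · exact Eventually.of_forall fun s => Measurable.comp
      (g := fun k : ℕ => (W k : ℝ≥0∞) * ENNReal.ofReal (lam k)) measurable_from_top
      (hc.measurable _)
  · filter_upwards [Ioc_mem_nhdsGT (NNReal.coe_pos.2 hδ)] with s hs
    exact hD _ (Real.toNNReal_le_iff_le_coe.2 hs.2)
  · filter_upwards [ae_condState hc t n] with ω hω
    refine tendsto_const_nhds.congr' ?_
    filter_upwards [eventually_eq_of_rightCts hc t ω] with s hs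
    rw [hs, hω]

/-- Monotonicity confines the path to finitely many states on the window, so the real supremum is
genuine and not the default value `0`. -/
theorem lam_le_supRate (hc : IsCountingProcess N) (t : ℝ≥0) {s h : ℝ≥0} (hs : s ≤ h) (ω : Ω) :
    lam (N (t + s) ω) ≤ supRate N lam t h ω := by
  have hfin : (Set.range fun u : Set.Icc t (t + h) => lam (N u ω)).Finite := by
    refine ((Set.finite_Iic (N (t + h) ω)).image lam).subset ?_
    rintro _ ⟨u, rfl⟩
    exact ⟨N u ω, hc.mono ω u.2.2, rfl⟩
  exact le_ciSup hfin.bddAbove (⟨t + s, le_self_add, add_le_add_right hs t⟩ : Set.Icc t (t + h))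

/-! ### Weights for the moments and the second-moment bound -/

theorem sum_range_one (n x : ℕ) :
    ∑ m ∈ Finset.range x, (if n ≤ m then 1 else 0) = x - n := by
  induction x with
  | zero => simp
  | succ x ih =>
    rw [Finset.sum_range_succ, ih]
    split_ifs <;> omega

/-- The sum telescopes through `(k + 1) ^ 2 - k ^ 2 = 2 * k + 1`. -/
theorem sum_range_odd (n x : ℕ) :
    ∑ m ∈ Finset.range x, (if n ≤ m then 2 * (m - n) + 1 else 0) = (x - n) ^ 2 := by
  induction x with
  | zero => simp
  | succ x ih =>
    rw [Finset.sum_range_succ, ih]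
    split_ifs with h
    · rw [Nat.sub_add_comm h]; ring
    · simp [show x - n = 0 by omega, show x + 1 - n = 0 by omega]

theorem sum_range_odd_trunc (n M x : ℕ) :
    ∑ m ∈ Finset.range x, (if n ≤ m ∧ m - n < M then 2 * (m - n) + 1 else 0) =
      (min (x - n) M) ^ 2 := by
  induction x with
  | zero => simp
  | succ x ih =>
    rw [Finset.sum_range_succ, ih]
    split_ifs with h
    · rw [min_eq_left h.2.le, Nat.sub_add_comm h.1, min_eq_left h.2]; ring
    · rw [add_zero]; congr 1; omega

theorem ennreal_two_mul_le_add_sq (a : ℕ) (r : ℝ) :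
    2 * (a : ℝ≥0∞) * ENNReal.ofReal r ≤ (a : ℝ≥0∞) ^ 2 + ENNReal.ofReal r ^ 2 := by
  have h := two_mul_le_add_sq (a : ℝ≥0) r.toNNReal
  have h' : ((2 * (a : ℝ≥0) * r.toNNReal : ℝ≥0) : ℝ≥0∞) ≤
    (((a : ℝ≥0) ^ 2 + r.toNNReal ^ 2 : ℝ≥0) : ℝ≥0∞) := ENNReal.coe_le_coe.2 h
  push_cast at h'
  exact h'

theorem lintegral_ofReal_sq_ne_top {μ : Measure Ω} {X : Ω → ℝ} (hX : MemLp X 2 μ) :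
    ∫⁻ ω, ENNReal.ofReal (X ω) ^ 2 ∂μ ≠ ∞ := by
  refine ne_top_of_le_ne_top hX.integrable_sq.lintegral_lt_top.ne (lintegral_mono fun ω => ?_)
  rcases le_total 0 (X ω) with h | h
  · rw [ENNReal.ofReal_pow h]
  · simp [ENNReal.ofReal_of_nonpos h]

/-- A self-bounding estimate. With `a` the truncated increment over the whole window and `L` the
supremum of the rate, the Dynkin integrand is at most `(2 * a + 1) * L ≤ a ^ 2 + L ^ 2 + L`. Hence
`f ≤ (f + C) * h`, and `h ≤ 1 / 2` absorbs `f`. The bound does not depend on `M`. -/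
theorem lintegral_trunc_sq_le (hN : IsSimpleMCP P N q lam) {t : ℝ≥0} {n : ℕ}
    (hn : Charged P N t n) {δ h : ℝ≥0} (hhδ : h ≤ δ) (hh : h ≤ 1 / 2) (M : ℕ) :
    ∫⁻ ω, (((min (N (t + h) ω - n) M) ^ 2 : ℕ) : ℝ≥0∞) ∂(condState P N t n) ≤
      ∫⁻ ω, (ENNReal.ofReal (supRate N lam t δ ω) ^ 2 + ENNReal.ofReal (supRate N lam t δ ω))
        ∂(condState P N t n) := by
  have := isProbabilityMeasure_condState hn
  have hc := hN.counting
  set f := ∫⁻ ω, (((min (N (t + h) ω - n) M) ^ 2 : ℕ) : ℝ≥0∞) ∂(condState P N t n)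
  set C := ∫⁻ ω, (ENNReal.ofReal (supRate N lam t δ ω) ^ 2 +
    ENNReal.ofReal (supRate N lam t δ ω)) ∂(condState P N t n)
  -- Truncation serves exactly this: `f` must be finite to be cancelled at the end.
  have hfin : f ≠ ∞ := by
    refine ne_top_of_le_ne_top (b := ((M ^ 2 : ℕ) : ℝ≥0∞)) (by simp) ?_
    calc f ≤ ∫⁻ _ω, ((M ^ 2 : ℕ) : ℝ≥0∞) ∂(condState P N t n) := lintegral_mono fun ω =>
          Nat.cast_le.2 (Nat.pow_le_pow_left (min_le_right _ _) 2)
      _ = _ := by simp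
  have hmeas : Measurable fun ω => (((min (N (t + h) ω - n) M) ^ 2 : ℕ) : ℝ≥0∞) :=
    Measurable.comp (g := fun k : ℕ => (((min (k - n) M) ^ 2 : ℕ) : ℝ≥0∞)) measurable_from_top
      (hc.measurable _)
  have hdyn := lintegral_sum_range_le hN hn
    (W := fun m => if n ≤ m ∧ m - n < M then 2 * (m - n) + 1 else 0)
    (fun m hm => if_neg fun h => by omega) (h := h)
    (D := fun ω => (((min (N (t + h) ω - n) M) ^ 2 : ℕ) : ℝ≥0∞) +
      (ENNReal.ofReal (supRate N lam t δ ω) ^ 2 + ENNReal.ofReal (supRate N lam t δ ω)))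
    (fun s hs => ae_of_all _ fun ω => by
      have hle : N (t + s) ω ≤ N (t + h) ω := hc.mono ω (add_le_add_right hs t)
      have hlam : ENNReal.ofReal (lam (N (t + s) ω)) ≤ ENNReal.ofReal (supRate N lam t δ ω) :=
        ENNReal.ofReal_le_ofReal (lam_le_supRate hc t (hs.trans hhδ) ω)
      have hW : (if n ≤ N (t + s) ω ∧ N (t + s) ω - n < M then 2 * (N (t + s) ω - n) + 1 else 0)
          ≤ 2 * min (N (t + h) ω - n) M + 1 := by
        split_ifs <;> omega
      calc _ ≤ ((2 * min (N (t + h) ω - n) M + 1 : ℕ) : ℝ≥0∞) *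
            ENNReal.ofReal (supRate N lam t δ ω) := mul_le_mul' (Nat.cast_le.2 hW) hlam
        _ = 2 * ((min (N (t + h) ω - n) M : ℕ) : ℝ≥0∞) * ENNReal.ofReal (supRate N lam t δ ω) +
            ENNReal.ofReal (supRate N lam t δ ω) := by rw [Nat.cast_add, Nat.cast_mul]; simp [add_mul]
        _ ≤ _ := by
            rw [← add_assoc, Nat.cast_pow]
            exact add_le_add_left (ennreal_two_mul_le_add_sq _ _) _)
  simp_rw [sum_range_odd_trunc] at hdyn
  rw [lintegral_add_left hmeas] at hdyn
  have h2 : (2 : ℝ≥0∞) * h ≤ 1 := by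
    have : (2 : ℝ≥0) * h ≤ 1 := by
      calc (2 : ℝ≥0) * h ≤ 2 * (1 / 2) := by gcongr
        _ = 1 := by norm_num
    exact_mod_cast this
  have h3 : f + f ≤ f + C := by
    calc f + f = 2 * f := (two_mul f).symm
      _ ≤ 2 * ((f + C) * h) := by gcongr
      _ = (f + C) * (2 * h) := by ring
      _ ≤ (f + C) * 1 := by gcongr
      _ = f + C := mul_one _
  exact (ENNReal.add_le_add_iff_left hfin).1 h3

/-- The second moment of the increment over a short window is finite. -/
theorem lintegral_increment_sq_ne_top (hN : IsSimpleMCP P N q lam) {t : ℝ≥0} {n : ℕ}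
    (hn : Charged P N t n) {δ h : ℝ≥0} (hhδ : h ≤ δ) (hh : h ≤ 1 / 2)
    (hL : MemLp (supRate N lam t δ) 2 (condState P N t n)) :
    ∫⁻ ω, (((N (t + h) ω - n) ^ 2 : ℕ) : ℝ≥0∞) ∂(condState P N t n) ≠ ∞ := by
  have := isProbabilityMeasure_condState hn
  have hC : ∫⁻ ω, (ENNReal.ofReal (supRate N lam t δ ω) ^ 2 +
      ENNReal.ofReal (supRate N lam t δ ω)) ∂(condState P N t n) ≠ ∞ := by
    rw [lintegral_add_right' _ hL.aestronglyMeasurable.aemeasurable.ennreal_ofReal]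
    exact ENNReal.add_ne_top.2 ⟨lintegral_ofReal_sq_ne_top hL,
      (hL.integrable one_le_two).lintegral_lt_top.ne⟩
  refine ne_top_of_le_ne_top hC ?_
  -- Monotone convergence in the truncation level transfers the uniform bound to the full square.
  have hsup : ∀ ω, (((N (t + h) ω - n) ^ 2 : ℕ) : ℝ≥0∞) ≤
      ⨆ M : ℕ, (((min (N (t + h) ω - n) M) ^ 2 : ℕ) : ℝ≥0∞) := fun ω =>
    le_iSup_of_le (N (t + h) ω - n) (by rw [min_self])
  refine (lintegral_mono hsup).trans ?_
  rw [lintegral_iSup]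
  · exact iSup_le fun M => lintegral_trunc_sq_le hN hn hhδ hh M
  · exact fun M => Measurable.comp (g := fun k : ℕ => (((min (k - n) M) ^ 2 : ℕ) : ℝ≥0∞))
      measurable_from_top (hN.counting.measurable _)
  · exact fun M M' hMM ω => Nat.cast_le.2
      (Nat.pow_le_pow_left (min_le_min_left _ hMM) 2)

/-! ### Infinitesimal mean and variance -/

theorem tendsto_lintegral_increment_div (hN : IsSimpleMCP P N q lam) {t : ℝ≥0} {n : ℕ}
    (hn : Charged P N t n) {δ : ℝ≥0} (hδ : 0 < δ)
    (hL : Integrable (supRate N lam t δ) (condState P N t n)) :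
    Tendsto (fun h : ℝ≥0 => (∫⁻ ω, ((N (t + h) ω - n : ℕ) : ℝ≥0∞) ∂(condState P N t n)) /
      (h : ℝ≥0∞)) (𝓝[>] 0) (𝓝 (ENNReal.ofReal (lam n))) := by
  have h := tendsto_lintegral_sum_range_div hN hn (W := fun m => if n ≤ m then 1 else 0)
    (fun m hm => if_neg (by omega)) hδ (D := fun ω => ENNReal.ofReal (supRate N lam t δ ω))
    hL.lintegral_lt_top.ne (fun s hs => ae_of_all _ fun ω => by
      refine (mul_le_of_le_one_left' ?_).trans
        (ENNReal.ofReal_le_ofReal (lam_le_supRate hN.counting t hs ω))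
      split_ifs <;> simp)
  simp_rw [sum_range_one] at h
  rwa [if_pos le_rfl, Nat.cast_one, one_mul] at h

/-- The dominating function uses the increment over the whole window `η`, which majorises all
earlier ones; `η ≤ 1 / 2` makes its square integrable by the self-bounding estimate. -/
theorem tendsto_lintegral_increment_sq_div (hN : IsSimpleMCP P N q lam) {t : ℝ≥0} {n : ℕ}
    (hn : Charged P N t n) {δ : ℝ≥0} (hδ : 0 < δ)
    (hL : MemLp (supRate N lam t δ) 2 (condState P N t n)) :
    Tendsto (fun h : ℝ≥0 => (∫⁻ ω, (((N (t + h) ω - n) ^ 2 : ℕ) : ℝ≥0∞) ∂(condState P N t n)) /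
      (h : ℝ≥0∞)) (𝓝[>] 0) (𝓝 (ENNReal.ofReal (lam n))) := by
  have := isProbabilityMeasure_condState hn
  have hc := hN.counting
  set η : ℝ≥0 := min δ (1 / 2)
  have hηpos : 0 < η := lt_min hδ (by norm_num)
  have hm : Measurable fun ω => (((N (t + η) ω - n) ^ 2 : ℕ) : ℝ≥0∞) :=
    Measurable.comp (g := fun k : ℕ => (((k - n) ^ 2 : ℕ) : ℝ≥0∞))
      measurable_from_top (hc.measurable _)
  have hDfin : ∫⁻ ω, ((((N (t + η) ω - n) ^ 2 : ℕ) : ℝ≥0∞) +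
      (ENNReal.ofReal (supRate N lam t δ ω) ^ 2 + ENNReal.ofReal (supRate N lam t δ ω)))
      ∂(condState P N t n) ≠ ∞ := by
    rw [lintegral_add_left hm,
      lintegral_add_right' _ hL.aestronglyMeasurable.aemeasurable.ennreal_ofReal]
    exact ENNReal.add_ne_top.2 ⟨lintegral_increment_sq_ne_top hN hn (min_le_left _ _)
      (min_le_right _ _) hL, ENNReal.add_ne_top.2 ⟨lintegral_ofReal_sq_ne_top hL,
      (hL.integrable one_le_two).lintegral_lt_top.ne⟩⟩
  have h := tendsto_lintegral_sum_range_div hN hn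
    (W := fun m => if n ≤ m then 2 * (m - n) + 1 else 0)
    (fun m hm => if_neg (by omega)) hηpos hDfin (fun s hs => ae_of_all _ fun ω => by
      have hle : N (t + s) ω ≤ N (t + η) ω := hc.mono ω (add_le_add_right hs t)
      have hlam : ENNReal.ofReal (lam (N (t + s) ω)) ≤ ENNReal.ofReal (supRate N lam t δ ω) :=
        ENNReal.ofReal_le_ofReal (lam_le_supRate hc t (hs.trans (min_le_left _ _)) ω)
      have hW : (if n ≤ N (t + s) ω then 2 * (N (t + s) ω - n) + 1 else 0)
          ≤ 2 * (N (t + η) ω - n) + 1 := by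
        split_ifs <;> omega
      calc _ ≤ ((2 * (N (t + η) ω - n) + 1 : ℕ) : ℝ≥0∞) *
            ENNReal.ofReal (supRate N lam t δ ω) := mul_le_mul' (Nat.cast_le.2 hW) hlam
        _ = 2 * ((N (t + η) ω - n : ℕ) : ℝ≥0∞) * ENNReal.ofReal (supRate N lam t δ ω) +
            ENNReal.ofReal (supRate N lam t δ ω) := by
            rw [Nat.cast_add, Nat.cast_mul]; simp [add_mul]
        _ ≤ _ := by
            rw [← add_assoc, Nat.cast_pow]
            exact add_le_add_left (ennreal_two_mul_le_add_sq _ _) _)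
  simpa [sum_range_odd] using h

theorem increment_ae_eq (hc : IsCountingProcess N) (t h : ℝ≥0) (n : ℕ) :
    increment N t h =ᵐ[condState P N t n] fun ω => ((N (t + h) ω - n : ℕ) : ℝ) := by
  filter_upwards [ae_condState hc t n] with ω hω
  have hle : N t ω ≤ N (t + h) ω := hc.mono ω le_self_add
  rw [increment, ← hω, Nat.cast_sub hle]

theorem integrable_natCast {μ : Measure Ω} {X : Ω → ℕ} (hX : Measurable X)
    (h : ∫⁻ ω, (X ω : ℝ≥0∞) ∂μ ≠ ∞) : Integrable (fun ω => (X ω : ℝ)) μ := by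
  refine (lintegral_ofReal_ne_top_iff_integrable
    (measurable_from_top.comp hX).aestronglyMeasurable (ae_of_all _ fun ω => by simp)).1 ?_
  simpa using h

theorem integral_natCast {μ : Measure Ω} {X : Ω → ℕ} (hX : Measurable X) :
    ∫ ω, (X ω : ℝ) ∂μ = (∫⁻ ω, (X ω : ℝ≥0∞) ∂μ).toReal := by
  have hm : Measurable fun ω => (X ω : ℝ) := measurable_from_top.comp hX
  rw [integral_eq_lintegral_of_nonneg_ae (ae_of_all _ fun ω => by simp) hm.aestronglyMeasurable]
  simp

/-- A finite limit in `ℝ≥0∞` makes the quotients eventually finite, so integrability comes with the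
convergence. -/
theorem eventually_integrable_and_tendsto {μ : Measure Ω} {X : ℝ≥0 → Ω → ℕ}
    (hX : ∀ h, Measurable (X h)) {l : ℝ} (hl : 0 ≤ l)
    (ht : Tendsto (fun h : ℝ≥0 => (∫⁻ ω, (X h ω : ℝ≥0∞) ∂μ) / (h : ℝ≥0∞)) (𝓝[>] 0)
      (𝓝 (ENNReal.ofReal l))) :
    (∀ᶠ h in 𝓝[>] (0 : ℝ≥0), Integrable (fun ω => (X h ω : ℝ)) μ) ∧
      Tendsto (fun h : ℝ≥0 => (h : ℝ)⁻¹ * ∫ ω, (X h ω : ℝ) ∂μ) (𝓝[>] 0) (𝓝 l) := by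
  constructor
  · filter_upwards [ht.eventually (gt_mem_nhds ENNReal.ofReal_lt_top)] with h hh
    refine integrable_natCast (hX h) fun htop => ?_
    rw [htop, ENNReal.top_div_of_ne_top ENNReal.coe_ne_top] at hh
    exact lt_irrefl _ hh
  · have h := (ENNReal.tendsto_toReal ENNReal.ofReal_ne_top).comp ht
    rw [ENNReal.toReal_ofReal hl] at h
    refine h.congr fun ε => ?_
    rw [Function.comp_apply, integral_natCast (hX ε), ENNReal.toReal_div, ENNReal.coe_toReal,
      div_eq_inv_mul]

theorem hasInfMean_of_integrable (hN : IsSimpleMCP P N q lam) {t : ℝ≥0} {n : ℕ}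
    (hn : Charged P N t n) {δ : ℝ≥0} (hδ : 0 < δ)
    (hL : Integrable (supRate N lam t δ) (condState P N t n)) :
    HasInfMean P N t n (lam n) := by
  obtain ⟨h1, h2⟩ := eventually_integrable_and_tendsto
    (fun h => Measurable.comp (g := fun k : ℕ => k - n) measurable_from_top
      (hN.counting.measurable (t + h)))
    (lam_nonneg hN ⟨t, hn⟩) (tendsto_lintegral_increment_div hN hn hδ hL)
  refine ⟨h1.mono fun h hh => hh.congr (increment_ae_eq hN.counting t h n).symm,
    h2.congr fun h => ?_⟩
  rw [integral_congr_ae (increment_ae_eq hN.counting t h n)]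
  rfl

theorem hasInfVar_of_memLp (hN : IsSimpleMCP P N q lam) {t : ℝ≥0} {n : ℕ}
    (hn : Charged P N t n) {δ : ℝ≥0} (hδ : 0 < δ)
    (hL : MemLp (supRate N lam t δ) 2 (condState P N t n)) :
    HasInfVar P N t n (lam n) := by
  have := isProbabilityMeasure_condState hn
  have hc := hN.counting
  obtain ⟨h1, h2⟩ := eventually_integrable_and_tendsto
    (fun h => Measurable.comp (g := fun k : ℕ => (k - n) ^ 2) measurable_from_top
      (hc.measurable (t + h)))
    (lam_nonneg hN ⟨t, hn⟩) (tendsto_lintegral_increment_sq_div hN hn hδ hL)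
  have hsq : ∀ h, (fun ω => increment N t h ω ^ 2) =ᵐ[condState P N t n]
      fun ω => (((N (t + h) ω - n) ^ 2 : ℕ) : ℝ) := fun h => by
    filter_upwards [increment_ae_eq hc t h n] with ω hω
    rw [hω, Nat.cast_pow]
  have hmeas : ∀ h, Measurable (increment N t h) := fun h =>
    (measurable_from_top.comp (hc.measurable (t + h))).sub
      (measurable_from_top.comp (hc.measurable t))
  have hmem : ∀ᶠ h in 𝓝[>] (0 : ℝ≥0), MemLp (increment N t h) 2 (condState P N t n) :=
    h1.mono fun h hh => (memLp_two_iff_integrable_sq (hmeas h).aestronglyMeasurable).2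
      (hh.congr (hsq h).symm)
  refine ⟨hmem, ?_⟩
  have hmean := (hasInfMean_of_integrable hN hn hδ (hL.integrable one_le_two)).2
  have hid : Tendsto (fun h : ℝ≥0 => (h : ℝ)) (𝓝[>] 0) (𝓝 0) :=
    tendsto_nhdsWithin_of_tendsto_nhds (NNReal.continuous_coe.tendsto' 0 0 rfl)
  -- The squared mean divided by `h` is `h` times the square of the normalised mean, hence tends to
  -- zero.
  have hlim := h2.sub (hid.mul (hmean.pow 2))
  rw [zero_mul, sub_zero] at hlim
  refine hlim.congr' ?_
  filter_upwards [hmem, self_mem_nhdsWithin] with h hh hpos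
  have h0 : (h : ℝ) ≠ 0 := by simpa using (ne_of_gt hpos : h ≠ 0)
  have hE : ∫ ω, (increment N t h ^ 2) ω ∂(condState P N t n) =
      ∫ ω, (((N (t + h) ω - n) ^ 2 : ℕ) : ℝ) ∂(condState P N t n) :=
    integral_congr_ae (hsq h)
  rw [variance_eq_sub hh, hE]
  simp only [Function.comp_apply]
  field_simp

end MCP

theorem mainTheorem3 {Ω : Type*} [MeasurableSpace Ω] (P : Measure Ω) [IsProbabilityMeasure P]
    (N : ℝ≥0 → Ω → ℕ) (q : ℕ → ℕ → ℝ) (lam : ℕ → ℝ) (hN : MCP.IsSimpleMCP P N q lam) :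
    (MCP.P1 P N lam →
      ∀ (t : ℝ≥0) (n : ℕ), MCP.Charged P N t n → MCP.HasInfMean P N t n (lam n)) ∧
    (MCP.P2 P N lam →
      (∀ (t : ℝ≥0) (n : ℕ), MCP.Charged P N t n →
        MCP.HasInfMean P N t n (lam n) ∧ MCP.HasInfVar P N t n (lam n)) ∧
      MCP.IsInfEquiDispersed P N) := by
  refine ⟨fun h1 t n hn => ?_, fun h2 => ?_⟩
  · obtain ⟨δ, hδ, hL⟩ := h1 t n hn
    exact MCP.hasInfMean_of_integrable hN hn hδ hL
  · have key : ∀ (t : ℝ≥0) (n : ℕ), MCP.Charged P N t n →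
        MCP.HasInfMean P N t n (lam n) ∧ MCP.HasInfVar P N t n (lam n) := by
      intro t n hn
      obtain ⟨δ, hδ, hL, hV⟩ := h2 t n hn
      have := MCP.isProbabilityMeasure_condState hn
      exact ⟨MCP.hasInfMean_of_integrable hN hn hδ hL, MCP.hasInfVar_of_memLp hN hn hδ
        ((evariance_lt_top_iff_memLp hL.aestronglyMeasurable).1 hV)⟩
    exact ⟨key, fun t n hn => ⟨lam n, lam n, (key t n hn).1, (key t n hn).2,
      fun h => div_self h, id⟩⟩
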